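/- Theorem 7.3 (girth bound for tangles). A finite graph $G$ consists of a finite vertex set $V_G$, a finite set $E^{\mathrm{dir}}_G$ of directed edges, head and tail maps $h_G,t_G\colon E^{\mathrm{dir}}_G\to V_G$, and an involution $\iota_G$ of $E^{\mathrm{dir}}_G$ with $t_G\circ\iota_G=h_G$; thus multiple edges, whole-loops and half-loops (self-loops $e$ with $\iota_G e=e$) are allowed. Its edge set $E_G$ is the set of orbits of $\iota_G$, and its order is $\mathrm{ord}(G)=\#E_G-\#V_G\in\mathbb Z$. Let $\mu_1(G)$ be the Perron–Frobenius eigenvalue (the spectral radius) of the Hashimoto matrix $H_G$, the square matrix indexed by $E^{\mathrm{dir}}_G$ whose $(e,f)$ entry is $1$ if $h_Ge=t_Gf$ and $\iota_Ge\ne f$, and $0$ otherwise. For real $\nu$ and $r\in\mathbb N$, a $(\ge\nu,<r)$-tangle is a connected finite graph $\psi$ with $\mu_1(\psi)\ge\nu$ and $\mathrm{ord}(\psi)<r$. The girth of $G$ is the least $k\ge1$ for which $G$ has a strictly non-backtracking closed walk of length $k$, i.e. a sequence $e_1,\dots,e_k$ of directed edges with $h_Ge_i=t_Ge_{i+1}$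 and $\iota_Ge_i\ne e_{i+1}$ for all $i=1,\dots,k$, where $e_{k+1}=e_1$ (and $\infty$ if there is no such walk); in a graph without half-loops this is the length of a shortest cycle. For every $r\in\mathbb N$ and every real $\nu>1$ there is a $g\in\mathbb N$ such that every $(\ge\nu,<r)$-tangle has girth at most $g$. -/

import Mathlib

/-- A graph with vertex set `V` and set of directed edges `E`: multiple edges, whole-loops and
half-loops (directed edges fixed by the involution `inv`) are allowed. -/
structure InvGraph (V : Type*) (E : Type*) where
  /-- the head of a directed edge -/
  head : E → V
  /-- the tail of a directed edge -/
  tail : E → V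
  /-- the orientation-reversing involution -/
  inv : E → E
  inv_involutive : Function.Involutive inv
  tail_inv : ∀ e, tail (inv e) = head e

namespace InvGraph

/-- Two directed edges are equivalent when they lie in the same orbit of the involution. -/
def edgeSetoid {V E : Type*} (G : InvGraph V E) : Setoid E where
  r e f := f = e ∨ f = G.inv e
  iseqv :=
    { refl := fun _ => Or.inl rfl
      symm := by
        rintro e f (h | h)
        · exact Or.inl h.symm
        · exact Or.inr (by rw [h, G.inv_involutive])
      trans := by
        rintro e f k (h | h) (h' | h')
        · exact Or.inl (by rw [h', h])
        · exact Or.inr (by rw [h', h])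
        · exact Or.inr (by rw [h', h])
        · exact Or.inl (by rw [h', h, G.inv_involutive]) }

/-- The edge set: the orbits of the involution on the directed edges. -/
def Edge {V E : Type*} (G : InvGraph V E) : Type _ := Quotient G.edgeSetoid

/-- The order of a finite graph, (number of edges) - (number of vertices). -/
noncomputable def order {V E : Type*} (G : InvGraph V E) : ℤ :=
  (Nat.card G.Edge : ℤ) - (Nat.card V : ℤ)

/-- A graph is connected if it has a vertex and any two vertices are joined by a walk. -/
def Connected {V E : Type*} (G : InvGraph V E) : Prop :=
  Nonempty V ∧
    ∀ u v : V, Relation.ReflTransGen (fun x y => ∃ e, G.tail e = x ∧ G.head e = y) u v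

/-- `e, f` are the consecutive directed edges of a non-backtracking walk of length two. -/
def NBStep {V E : Type*} (G : InvGraph V E) (e f : E) : Prop :=
  G.head e = G.tail f ∧ G.inv e ≠ f

open Classical in
/-- The Hashimoto (non-backtracking) matrix, indexed by the directed edges. -/
noncomputable def hashimoto {V E : Type*} (G : InvGraph V E) : Matrix E E ℂ :=
  Matrix.of fun e f => if G.NBStep e f then 1 else 0

open Classical in
/-- The Perron-Frobenius eigenvalue of the Hashimoto matrix. For a matrix with nonnegative entries
this is the spectral radius, i.e. the largest modulus of a complex eigenvalue
(it is `0` if there are no directed edges). -/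
noncomputable def mu1 {V E : Type*} [Fintype E] (G : InvGraph V E) : ℝ :=
  (spectralRadius ℂ G.hashimoto).toReal

/-- The sequence `w = [e₁, …, e_k]`, `k ≥ 1`, of directed edges forms a strictly non-backtracking
closed walk: every two cyclically consecutive terms (also `e_k, e₁`, including the case `k = 1`)
form a non-backtracking step. -/
def IsSNBC {V E : Type*} (G : InvGraph V E) (w : List E) : Prop :=
  w.IsChain G.NBStep ∧ ∃ h : w ≠ [], G.NBStep (w.getLast h) (w.head h)

/-- The girth: the least length of a strictly non-backtracking closed walk of positive length
(`⊤` if there is none). In a graph without half-loops this is the length of a shortest cycle,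
where a whole-loop is a cycle of length `1` and a pair of parallel edges one of length `2`. -/
noncomputable def girth {V E : Type*} (G : InvGraph V E) : ℕ∞ :=
  ⨅ (w : List E) (_ : G.IsSNBC w), (w.length : ℕ∞)

/-- A `(≥ ν, < r)`-tangle: a connected graph with `μ₁ ≥ ν` and order less than `r`. -/
def IsTangle {V E : Type*} [Fintype E] (G : InvGraph V E) (ν : ℝ) (r : ℕ) : Prop :=
  G.Connected ∧ ν ≤ G.mu1 ∧ G.order < (r : ℤ)

end InvGraph

/-! A spanning tree leaves at most `2 * r` directed edges outside it; call this set `S`. Give the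
edges of `S` a small weight `z`: non-backtracking walks in a tree climb towards the root and then
descend, so the weighted transfer operator has a positive superharmonic function of rate `β` close
to `1` (`Connected.exists_superharmonic`). A walk shorter than the girth repeats no directed edge,
so the weights cost it at most `z ^ (2 * r)` in total (`pow_mul_transfer_iterate_le`). The
unweighted operator grows at rate at least `μ > β` on the moduli of an eigenvector. If the girth
exceeded `g`, then `z ^ (2 * r) * μ ^ g ≤ β ^ g`, which fails for some `g` depending only on `r` and
`ν`. -/

namespace InvGraph

open Finset

/-! ### Forests and spanning trees. -/

/-- Let `par` be a parent map on the vertices satisfying `P`, decreasing the depth `d`. A nonnegative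
mass `q` on the vertices of the forest has a function `Y`, the mass of all descendants, that
dominates the mass at a vertex plus its own values at the children. -/
theorem exists_subtree_mass {V : Type*} [Fintype V] [DecidableEq V] (P : V → Prop)
    [DecidablePred P] (par : V → V) (d : V → ℕ) (hd : ∀ v, P v → d (par v) < d v)
    (q : V → ℝ) (hq : ∀ v, 0 ≤ q v) :
    ∃ Y : V → ℝ, (∀ v, (∑ w with P w ∧ par w = v, Y w) + q v ≤ Y v) ∧
      ∀ v, 0 ≤ Y v ∧ Y v ≤ ∑ u, q u := by
  classical
  let R : V → V → Prop := fun a b => P a ∧ par a = b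
  have hmono : ∀ {a b}, Relation.ReflTransGen R a b → d b ≤ d a := by
    intro a b h
    induction h with
    | refl => exact le_rfl
    | tail _ hbc ih =>
      obtain ⟨hP, rfl⟩ := hbc
      exact (hd _ hP).le.trans ih
  have hdet : Relator.RightUnique R := by
    rintro a b c ⟨_, rfl⟩ ⟨_, rfl⟩
    rfl
  -- A path from one sibling to a different one would pass through their common parent, where the
  -- depth is already too small.
  have hsib : ∀ {v w w'}, R w v → R w' v → Relation.ReflTransGen R w w' → w = w' := by
    intro v w w' hw hw' h
    rcases h.cases_head with h | ⟨c, hc, hcw⟩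
    · exact h
    · have hcv : c = v := hdet hc hw
      subst hcv
      have h1 := hmono hcw
      have h2 := hd _ hw'.1
      rw [hw'.2] at h2
      omega
  refine ⟨fun v => ∑ u, if Relation.ReflTransGen R u v then q u else 0, fun v => ?_,
    fun v => ⟨?_, ?_⟩⟩
  · rw [Finset.sum_comm]
    have hqv : q v = ∑ u, if u = v then q u else 0 := by simp
    rw [hqv, ← Finset.sum_add_distrib]
    refine Finset.sum_le_sum fun u _ => ?_
    -- By `hsib`, each `u` lies below at most one child of `v`, so its mass is counted once.
    by_cases hex : ∃ w, R w v ∧ Relation.ReflTransGen R u w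
    · obtain ⟨w, hw, huw⟩ := hex
      have hne : u ≠ v := by
        rintro rfl
        have h1 := hmono huw
        have h2 := hd _ hw.1
        rw [hw.2] at h2
        omega
      rw [if_neg hne, if_pos (huw.tail hw), add_zero]
      rw [Finset.sum_eq_single w]
      · split_ifs
        simp
      · intro w' hw' hne'
        rw [if_neg]
        intro huw'
        have hw'' : R w' v := (Finset.mem_filter.1 hw').2
        rcases Relation.ReflTransGen.total_of_right_unique hdet huw huw' with h | h
        · exact hne' (hsib hw hw'' h).symm
        · exact hne' (hsib hw'' hw h)
      · intro h
        exact absurd (Finset.mem_filter.2 ⟨Finset.mem_univ w, (hw : P w ∧ par w = v)⟩) h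
    · rw [Finset.sum_eq_zero, zero_add]
      · by_cases huv : u = v
        · subst huv
          simp [Relation.ReflTransGen.refl]
        · rw [if_neg huv]
          split_ifs <;> simp [hq]
      · intro w hw
        rw [if_neg]
        exact fun h => hex ⟨w, (Finset.mem_filter.1 hw).2, h⟩
  · exact Finset.sum_nonneg fun u _ => by split_ifs <;> simp [hq]
  · exact Finset.sum_le_sum fun u _ => by split_ifs <;> simp [hq]

variable {V E : Type*} (G : InvGraph V E)

theorem head_inv (e : E) : G.head (G.inv e) = G.tail e := by
  rw [← G.tail_inv, G.inv_involutive]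

/-- A connected graph has a spanning tree: every vertex apart from a root has an edge `p v` to a
parent of smaller depth. -/
theorem Connected.exists_parent {G : InvGraph V E} (h : G.Connected) :
    ∃ (root : V) (d : V → ℕ) (p : {v // v ≠ root} → E),
      ∀ v, G.tail (p v) = v ∧ d (G.head (p v)) < d v := by
  classical
  obtain ⟨⟨root⟩, hconn⟩ := h
  -- The `n`-th iterate on `v = root` says that some walk of length `n` leads from `v` to the root;
  -- the depth is the least such `n`.
  let F : (V → Prop) → V → Prop := fun P v => ∃ e, G.tail e = v ∧ P (G.head e)
  have hW : ∀ v, ∃ n, F^[n] (fun v => v = root) v := by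
    intro v
    induction hconn v root using Relation.ReflTransGen.head_induction_on with
    | refl => exact ⟨0, rfl⟩
    | head hac _ ih =>
      obtain ⟨e, rfl, rfl⟩ := hac
      obtain ⟨n, hn⟩ := ih
      refine ⟨n + 1, ?_⟩
      rw [Function.iterate_succ_apply']
      exact ⟨e, rfl, hn⟩
  let depth : V → ℕ := fun v => Nat.find (hW v)
  have key : ∀ v : {v // v ≠ root}, ∃ e, G.tail e = v.1 ∧ depth (G.head e) < depth v.1 := by
    rintro ⟨v, hv⟩
    have hs : F^[depth v] (fun v => v = root) v := Nat.find_spec (hW v)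
    generalize depth v = m at hs
    cases m with
    | zero => exact absurd hs hv
    | succ n =>
      rw [Function.iterate_succ_apply'] at hs
      obtain ⟨e, he, hen⟩ := hs
      exact ⟨e, he, Nat.lt_succ_of_le (Nat.find_min' _ hen)⟩
  choose p hp using key
  exact ⟨root, depth, p, hp⟩

/-- The directed edges outside a spanning tree number at most twice `order + 1`. -/
theorem card_nontree_le [Fintype V] [Fintype E] {root : V} {d : V → ℕ}
    {p : {v // v ≠ root} → E} (hp : ∀ v, G.tail (p v) = v ∧ d (G.head (p v)) < d v)
    (S : Finset E) (hS : ∀ e ∈ S, ∀ v, e ≠ p v ∧ e ≠ G.inv (p v)) :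
    (S.card : ℤ) ≤ 2 * (G.order + 1) := by
  classical
  let π : E → G.Edge := Quotient.mk G.edgeSetoid
  have hπ : ∀ {e f}, π e = π f → f = e ∨ f = G.inv e := fun h => Quotient.exact h
  have : Fintype G.Edge := Fintype.ofSurjective π Quotient.mk_surjective
  have h1 : S.card ≤ 2 * (S.image π).card := by
    refine Finset.card_le_mul_card_image S 2 fun b hb => ?_
    obtain ⟨e, he, rfl⟩ := Finset.mem_image.1 hb
    calc (S.filter fun a => π a = π e).card ≤ ({e, G.inv e} : Finset E).card := by
          refine Finset.card_le_card fun a ha => ?_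
          have := hπ (Finset.mem_filter.1 ha).2.symm
          simpa using this
      _ ≤ 2 := Finset.card_le_two
  have hinj : Function.Injective fun v => π (p v) := by
    intro v w hvw
    rcases hπ hvw with h | h
    · apply Subtype.ext
      rw [← (hp v).1, ← (hp w).1, h]
    -- If `p v` and `p w` were mutually inverse, `v` and `w` would each be the other's parent.
    · exfalso
      have h3 := (hp v).2
      have h4 := (hp w).2
      have h5 : G.head (p w) = v := by rw [h, head_inv, (hp v).1]
      have h6 : G.head (p v) = w := by rw [← G.tail_inv, ← h, (hp w).1]
      rw [h6] at h3
      rw [h5] at h4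
      omega
  have hdisj : Disjoint (S.image π) (Finset.univ.image fun v => π (p v)) := by
    rw [Finset.disjoint_left]
    intro b hb hb'
    obtain ⟨e, he, rfl⟩ := Finset.mem_image.1 hb
    obtain ⟨v, _, hv⟩ := Finset.mem_image.1 hb'
    rcases hπ hv with h | h
    · exact (hS e he v).1 h
    · exact (hS e he v).2 h
  -- The tree uses `#V - 1` edges, which leaves at most `order + 1` for `S`.
  have h2 := Finset.card_le_univ (S.image π ∪ Finset.univ.image fun v => π (p v))
  rw [Finset.card_union_of_disjoint hdisj, Finset.card_image_of_injective _ hinj,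
    Finset.card_univ, Fintype.card_subtype_compl, Fintype.card_subtype_eq] at h2
  have h7 : 0 < Fintype.card V := Fintype.card_pos_iff.2 ⟨root⟩
  unfold order
  rw [Nat.card_eq_fintype_card, Nat.card_eq_fintype_card]
  omega

/-! ### Weighted transfer operators and walks below the girth. -/

open Classical in
/-- The weighted non-backtracking transfer operator. -/
noncomputable def transfer [Fintype E] (c : E → ℝ) (y : E → ℝ) (e : E) : ℝ :=
  ∑ f with G.NBStep e f, c f * y f

variable {G}

theorem transfer_mono [Fintype E] {c : E → ℝ} (hc : 0 ≤ c) : Monotone (G.transfer c) :=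
  fun _ _ h _ => Finset.sum_le_sum fun f _ => mul_le_mul_of_nonneg_left (h f) (hc f)

theorem transfer_smul [Fintype E] (c : E → ℝ) (t : ℝ) (y : E → ℝ) :
    G.transfer c (t • y) = t • G.transfer c y := by
  funext e
  simp only [transfer, Pi.smul_apply, smul_eq_mul, Finset.mul_sum]
  exact Finset.sum_congr rfl fun f _ => by ring

theorem transfer_iterate_le [Fintype E] {c : E → ℝ} (hc : 0 ≤ c) {β : ℝ} (hβ : 0 ≤ β)
    {y : E → ℝ} (h : G.transfer c y ≤ β • y) (n : ℕ) : (G.transfer c)^[n] y ≤ β ^ n • y := by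
  induction n with
  | zero => simp
  | succ n ih =>
    rw [Function.iterate_succ_apply']
    refine (transfer_mono hc ih).trans ?_
    rw [transfer_smul, pow_succ, mul_smul]
    exact smul_le_smul_of_nonneg_left h (pow_nonneg hβ n)

theorem le_transfer_iterate [Fintype E] {c : E → ℝ} (hc : 0 ≤ c) {β : ℝ} (hβ : 0 ≤ β)
    {y : E → ℝ} (h : β • y ≤ G.transfer c y) (n : ℕ) : β ^ n • y ≤ (G.transfer c)^[n] y := by
  induction n with
  | zero => simp
  | succ n ih =>
    rw [Function.iterate_succ_apply']
    refine le_trans ?_ (transfer_mono hc ih)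
    rw [transfer_smul, pow_succ, mul_smul]
    exact smul_le_smul_of_nonneg_left h (pow_nonneg hβ n)

theorem transfer_iterate_smul [Fintype E] (c : E → ℝ) (t : ℝ) (y : E → ℝ) (n : ℕ) :
    (G.transfer c)^[n] (t • y) = t • (G.transfer c)^[n] y := by
  induction n with
  | zero => rfl
  | succ n ih => rw [Function.iterate_succ_apply', Function.iterate_succ_apply', ih, transfer_smul]

theorem transfer_nonneg [Fintype E] {c : E → ℝ} (hc : 0 ≤ c) {y : E → ℝ} (hy : 0 ≤ y) :
    0 ≤ G.transfer c y :=
  fun _ => Finset.sum_nonneg fun f _ => mul_nonneg (hc f) (hy f)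

/-- A non-backtracking walk shorter than the girth does not repeat a directed edge. -/
theorem notMem_of_isChain_of_lt_girth {l : List E} {e f : E} (hl : (l ++ [e]).IsChain G.NBStep)
    (hf : G.NBStep e f) (hlen : ((l ++ [e]).length : ℕ∞) < G.girth) : f ∉ l ++ [e] := by
  intro hmem
  obtain ⟨l₁, l₂, h⟩ := List.append_of_mem hmem
  have hlast : (f :: l₂).getLast (by simp) = e := by
    have h1 : (l ++ [e]).getLast? = some e := by simp
    rw [h, List.getLast?_append_of_ne_nil _ (by simp),
      List.getLast?_eq_some_getLast (List.cons_ne_nil _ _)] at h1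
    exact Option.some.inj h1
  have hsnbc : G.IsSNBC (f :: l₂) := by
    refine ⟨?_, by simp, ?_⟩
    · rw [h] at hl
      exact hl.right_of_append
    · rw [hlast]
      exact hf
  have h2 : G.girth ≤ ((f :: l₂).length : ℕ∞) := iInf₂_le _ hsnbc
  have h3 : (f :: l₂).length ≤ (l ++ [e]).length := by
    rw [h, List.length_append]
    omega
  exact absurd (hlen.trans_le h2) (not_lt.2 (by exact_mod_cast h3))

open Classical in
/-- Weighting the edges of `S` by `z` costs at most a factor `z ^ #S` over a time below the girth,
for every edge of `S` is traversed at most once. -/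
theorem pow_mul_transfer_iterate_le [Fintype E] (S : Finset E) {z : ℝ} (hz : 0 ≤ z)
    (hz1 : z ≤ 1) {y : E → ℝ} (hy : 0 ≤ y) (n : ℕ) (l : List E) (e : E) (hl : (l ++ [e]).IsChain G.NBStep)
    (hlen : ((l.length + n : ℕ) : ℕ∞) < G.girth) :
    z ^ (S \ (l ++ [e]).toFinset).card * (G.transfer 1)^[n] y e ≤
      (G.transfer fun f => if f ∈ S then z else 1)^[n] y e := by
  have hc1 : (0 : E → ℝ) ≤ 1 := fun _ => zero_le_one
  have hnn : ∀ n, 0 ≤ (G.transfer 1)^[n] y := by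
    intro n
    induction n with
    | zero => exact hy
    | succ n ih =>
      rw [Function.iterate_succ_apply']
      exact transfer_nonneg hc1 ih
  -- `l ++ [e]` records the walk so far. The exponent counts the edges of `S` not yet met, and drops
  -- by one exactly when a factor `z` is paid.
  induction n generalizing l e with
  | zero => exact mul_le_of_le_one_left (hy e) (pow_le_one₀ hz hz1)
  | succ n ih =>
    rw [Function.iterate_succ_apply', Function.iterate_succ_apply', transfer, transfer,
      Finset.mul_sum]
    refine Finset.sum_le_sum fun f hf => ?_
    have hef : G.NBStep e f := (Finset.mem_filter.1 hf).2
    have hl' : ((l ++ [e]) ++ [f]).IsChain G.NBStep := by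
      refine hl.append (List.isChain_singleton f) ?_
      simpa using hef
    have hnot : f ∉ l ++ [e] := notMem_of_isChain_of_lt_girth hl hef
      (lt_of_le_of_lt (by simp only [List.length_append, List.length_singleton]; gcongr; omega)
        hlen)
    have hstep := ih (l ++ [e]) f hl' (by
      rwa [List.length_append, List.length_singleton, add_assoc, add_comm 1 n])
    have hsdiff : S \ ((l ++ [e]) ++ [f]).toFinset = (S \ (l ++ [e]).toFinset).erase f := by
      ext x
      simp only [Finset.mem_sdiff, Finset.mem_erase, List.mem_toFinset, List.mem_append,
        List.mem_singleton]
      tauto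
    rw [hsdiff] at hstep
    rw [Pi.one_apply, one_mul]
    by_cases hfS : f ∈ S
    · have hmem : f ∈ S \ (l ++ [e]).toFinset := by
        rw [Finset.mem_sdiff, List.mem_toFinset]
        exact ⟨hfS, hnot⟩
      rw [if_pos hfS, ← Finset.card_erase_add_one hmem, pow_succ', mul_assoc]
      exact mul_le_mul_of_nonneg_left hstep hz
    · rw [if_neg hfS, one_mul]
      rwa [Finset.erase_eq_of_notMem (by simp [hfS])] at hstep

open Classical in
/-- If the weighted transfer operator has a positive `β`-superharmonic function, an eigenvalue
larger than `β` bounds the girth. -/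
theorem girth_le_of_superharmonic [Fintype E] (S : Finset E) {z β ν : ℝ}
    (hz : 0 < z) (hz1 : z ≤ 1) (hβ : 0 ≤ β) (hν : 0 ≤ ν) {y a : E → ℝ} (hy : ∀ e, 0 < y e)
    (hyβ : (G.transfer fun f => if f ∈ S then z else 1) y ≤ β • y)
    (ha : 0 ≤ a) (ha0 : a ≠ 0) (haν : ν • a ≤ G.transfer 1 a)
    {N g : ℕ} (hS : S.card ≤ N) (hg : β ^ g < z ^ N * ν ^ g) : G.girth ≤ g := by
  by_contra! hlt
  obtain ⟨e₀, he₀⟩ := Function.ne_iff.1 ha0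
  have hpos₀ : 0 < a e₀ := lt_of_le_of_ne (ha e₀) (Ne.symm he₀)
  -- At a maximum of `a / y` the values of `y` cancel, so no lower bound on `y` uniform in the graph
  -- is needed.
  obtain ⟨e, -, he⟩ := Finset.exists_max_image Finset.univ (fun e => a e / y e)
    ⟨e₀, Finset.mem_univ _⟩
  have hpos : 0 < a e := by
    have h1 := (div_pos hpos₀ (hy e₀)).trans_le (he e₀ (Finset.mem_univ _))
    exact (div_pos_iff_of_pos_right (hy e)).1 h1
  have hay : a ≤ (a e / y e) • y := fun f => by
    have := he f (Finset.mem_univ _)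
    rwa [div_le_iff₀ (hy f)] at this
  have hc : (0 : E → ℝ) ≤ fun f => if f ∈ S then z else 1 := fun f => by
    dsimp only [Pi.zero_apply]
    split_ifs
    exacts [hz.le, zero_le_one]
  have h1 := le_transfer_iterate (fun _ => zero_le_one) hν haν g e
  have h2 := pow_mul_transfer_iterate_le S hz.le hz1 ha g [] e (List.isChain_singleton e)
    (by simpa using hlt)
  have h3 := (transfer_mono (G := G) hc).iterate g hay e
  rw [transfer_iterate_smul] at h3
  have h4 := transfer_iterate_le hc hβ hyβ g e
  simp only [Pi.smul_apply, smul_eq_mul] at h1 h3 h4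
  have h5 : a e / y e * (G.transfer fun f => if f ∈ S then z else 1)^[g] y e ≤ β ^ g * a e := by
    refine (mul_le_mul_of_nonneg_left h4 (div_pos hpos (hy e)).le).trans_eq ?_
    have := (hy e).ne'
    field_simp
  have h6 : z ^ N ≤ z ^ (S \ ([] ++ [e]).toFinset).card :=
    pow_le_pow_of_le_one hz.le hz1 ((Finset.card_le_card Finset.sdiff_subset).trans hS)
  have h7 : z ^ N * (ν ^ g * a e) ≤ β ^ g * a e := by
    refine le_trans ?_ ((h2.trans h3).trans h5)
    exact mul_le_mul h6 h1 (mul_nonneg (pow_nonneg hν g) hpos.le) (pow_nonneg hz.le _)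
  rw [← mul_assoc] at h7
  exact absurd (le_of_mul_le_mul_right h7 hpos) (not_le.2 hg)

/-! ### Subharmonic and superharmonic functions. -/

/-- An eigenvalue of large modulus of the Hashimoto matrix gives a nonnegative subharmonic
function. -/
theorem exists_subharmonic_of_lt_mu1 [Fintype E] {ν : ℝ} (hν : 0 ≤ ν) (h : ν < G.mu1) :
    ∃ a : E → ℝ, 0 ≤ a ∧ a ≠ 0 ∧ ν • a ≤ G.transfer 1 a := by
  classical
  have h1 : ENNReal.ofReal ν < spectralRadius ℂ G.hashimoto := by
    refine (ENNReal.ofReal_lt_iff_lt_toReal hν ?_).2 ?_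
    -- An infinite spectral radius would be read as `0` by `toReal`.
    · intro htop
      have : G.mu1 = 0 := by
        unfold mu1
        convert ENNReal.toReal_top
      linarith
    · unfold mu1 at h
      convert h
  obtain ⟨k, hk⟩ := lt_iSup_iff.1 h1
  obtain ⟨hmem, hk⟩ := lt_iSup_iff.1 hk
  have hkν : ν ≤ ‖k‖ := by
    have h2 : ENNReal.ofReal ν < ENNReal.ofReal ‖k‖ := by
      rwa [ofReal_norm]
    exact ((ENNReal.ofReal_lt_ofReal_iff_of_nonneg hν).1 h2).le
  rw [← Matrix.spectrum_toLin', ← Module.End.hasEigenvalue_iff_mem_spectrum] at hmem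
  obtain ⟨x, hx⟩ := hmem.exists_hasEigenvector
  refine ⟨fun e => ‖x e‖, fun e => norm_nonneg _, ?_, fun e => ?_⟩
  · intro h0
    exact hx.2 (funext fun e => norm_eq_zero.1 (congrFun h0 e))
  · have h3 := congrFun hx.apply_eq_smul e
    rw [Matrix.toLin'_apply] at h3
    simp only [Pi.smul_apply, smul_eq_mul, transfer, Pi.one_apply, one_mul]
    calc ν * ‖x e‖ ≤ ‖k‖ * ‖x e‖ := mul_le_mul_of_nonneg_right hkν (norm_nonneg _)
      _ = ‖∑ f with G.NBStep e f, x f‖ := by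
        rw [← norm_mul, Finset.sum_filter]
        simp only [Pi.smul_apply, smul_eq_mul] at h3
        rw [← h3]
        simp only [Matrix.mulVec, dotProduct, hashimoto, Matrix.of_apply, ite_mul, one_mul,
          zero_mul]
      _ ≤ _ := norm_sum_le _ _

open Classical in
/-- The set of directed edges outside a spanning tree can be chosen of bounded size, and if it is
given a small weight, the transfer operator has a positive superharmonic function of rate close
to `1`. -/
theorem Connected.exists_superharmonic [Fintype V] [Fintype E] (h : G.Connected) {r : ℕ}
    (hr : G.order < r) {z δ : ℝ} (hz : 0 < z) (hδ : 0 < δ) (hzδ : z * (2 * r : ℕ) ≤ δ / 2) :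
    ∃ S : Finset E, S.card ≤ 2 * r ∧ ∃ y : E → ℝ, (∀ e, 0 < y e) ∧
      (G.transfer fun f => if f ∈ S then z else 1) y ≤ (1 + δ) • y := by
  obtain ⟨root, d, p, hp⟩ := h.exists_parent
  let S : Finset E := {e | ∀ v, e ≠ p v ∧ e ≠ G.inv (p v)}
  have hmemS : ∀ e, e ∈ S ↔ ∀ v, e ≠ p v ∧ e ≠ G.inv (p v) := by simp [S]
  have hcard : S.card ≤ 2 * r := by
    have := G.card_nontree_le hp S fun e he => (hmemS e).1 he
    omega
  let par : V → V := fun v => if hv : v ≠ root then G.head (p ⟨v, hv⟩) else v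
  have hpar : ∀ v : {v // v ≠ root}, par v = G.head (p v) := fun v => dif_pos v.2
  have hV : 0 < (Fintype.card V : ℝ) := Nat.cast_pos.2 (Fintype.card_pos_iff.2 ⟨root⟩)
  -- Spread over all vertices, `ε` uses half of the budget `δ` and makes `Y` positive; the weights
  -- `z` on `S` use at most the other half.
  let ε : ℝ := δ / 2 / Fintype.card V
  have hε : 0 < ε := by positivity
  let q : V → ℝ := fun v => (∑ f ∈ S with G.tail f = v, z) + ε
  have hq : ∀ v, ε ≤ q v := fun v =>
    le_add_of_nonneg_left (Finset.sum_nonneg fun _ _ => hz.le)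
  have hqsum : ∑ v, q v ≤ δ := by
    simp only [q, Finset.sum_add_distrib]
    have h0 : ∑ v, ∑ f ∈ S with G.tail f = v, z = ∑ f ∈ S, z := Finset.sum_fiberwise _ _ _
    rw [h0, Finset.sum_const, Finset.sum_const, nsmul_eq_mul, nsmul_eq_mul,
      Finset.card_univ, mul_div_cancel₀ _ hV.ne']
    have h1 : (S.card : ℝ) ≤ (2 * r : ℕ) := Nat.cast_le.2 hcard
    have h2 := mul_le_mul_of_nonneg_left h1 hz.le
    linarith
  obtain ⟨Y, hY, hYb⟩ := exists_subtree_mass (fun v => v ≠ root) par d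
    (fun v hv => by rw [hpar ⟨v, hv⟩]; exact (hp ⟨v, hv⟩).2) q fun v => hε.le.trans (hq v)
  have hYpos : ∀ v, 0 < Y v := fun v => by
    have h1 : 0 ≤ ∑ w with w ≠ root ∧ par w = v, Y w := Finset.sum_nonneg fun w _ => (hYb w).1
    linarith [hY v, hq v]
  have hYδ : ∀ v, Y v ≤ δ := fun v => (hYb v).2.trans hqsum
  -- `D` consists of the tree edges directed away from the root. Edges of `S` and tree edges towards
  -- the root get the value `1`.
  let D : Finset E := Finset.univ.image fun v => G.inv (p v)
  let y : E → ℝ := fun e => if e ∈ D then Y (G.head e) else 1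
  have hD : ∀ u, ∑ f ∈ D with G.tail f = u, Y (G.head f) ≤ ∑ w with w ≠ root ∧ par w = u, Y w := by
    intro u
    have hhead : ∀ v, G.head (G.inv (p v)) = v := fun v => by rw [head_inv, (hp v).1]
    rw [← Finset.sum_image (s := D.filter fun f => G.tail f = u) (g := G.head) (f := Y)]
    · refine Finset.sum_le_sum_of_subset_of_nonneg (fun w hw => ?_) fun w _ _ => (hYb w).1
      obtain ⟨f, hf, rfl⟩ := Finset.mem_image.1 hw
      obtain ⟨hfD, hfu⟩ := Finset.mem_filter.1 hf
      obtain ⟨v, -, rfl⟩ := Finset.mem_image.1 hfD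
      rw [hhead]
      refine Finset.mem_filter.2 ⟨Finset.mem_univ _, v.2, ?_⟩
      rw [hpar, ← hfu, G.tail_inv]
    · intro f hf f' hf' hff'
      obtain ⟨v, -, rfl⟩ := Finset.mem_image.1 (Finset.mem_filter.1 hf).1
      obtain ⟨w, -, rfl⟩ := Finset.mem_image.1 (Finset.mem_filter.1 hf').1
      simp only [hhead] at hff'
      rw [Subtype.ext hff']
  have hsum : ∀ u, (∑ f ∈ D with G.tail f = u, Y (G.head f)) + ∑ f ∈ S with G.tail f = u, z ≤
      Y u := fun u => by
    have := hY u
    have := hD u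
    simp only [q] at *
    linarith
  refine ⟨S, hcard, y, fun e => ?_, fun e => ?_⟩
  · dsimp only [y]
    split_ifs
    exacts [hYpos _, one_pos]
  · have hup : ∀ f, f ∉ D → f ∉ S → ∃ v, f = p v := fun f hfD hfS => by
      by_contra! hne
      exact hfS ((hmemS f).2 fun v => ⟨hne v, fun hf =>
        hfD (Finset.mem_image.2 ⟨v, Finset.mem_univ _, hf.symm⟩)⟩)
    have hupeq : ∀ f v, f ∉ D → f ∉ S → G.tail f = v.1 → f = p v := fun f v hfD hfS hf => by
      obtain ⟨w, rfl⟩ := hup f hfD hfS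
      rw [(hp w).1] at hf
      rw [Subtype.ext hf]
    have hterm : ∀ f, (if f ∈ S then z else 1) * y f ≤ (if f ∈ D then Y (G.head f) else 0) +
        (if f ∈ S then z else 0) + if f ∉ D ∧ f ∉ S then 1 else 0 := fun f => by
      by_cases hfS : f ∈ S
      · have hfD : f ∉ D := fun hfD => by
          obtain ⟨v, -, rfl⟩ := Finset.mem_image.1 hfD
          exact ((hmemS _).1 hfS v).2 rfl
        simp [y, hfS, hfD]
      · by_cases hfD : f ∈ D <;> simp [y, hfS, hfD]
    have hD' : (∑ f with G.NBStep e f, if f ∈ D then Y (G.head f) else 0) ≤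
        ∑ f ∈ D with G.tail f = G.head e, Y (G.head f) := by
      rw [← Finset.sum_filter]
      refine Finset.sum_le_sum_of_subset_of_nonneg (fun f hf => ?_) fun f _ _ => (hYb _).1
      simp only [Finset.mem_filter, Finset.mem_univ, true_and] at hf ⊢
      exact ⟨hf.2, hf.1.1.symm⟩
    have hS' : (∑ f with G.NBStep e f, if f ∈ S then z else 0) ≤
        ∑ f ∈ S with G.tail f = G.head e, z := by
      rw [← Finset.sum_filter]
      refine Finset.sum_le_sum_of_subset_of_nonneg (fun f hf => ?_) fun f _ _ => hz.le
      simp only [Finset.mem_filter, Finset.mem_univ, true_and] at hf ⊢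
      exact ⟨hf.2, hf.1.1.symm⟩
    have htotal : G.transfer (fun f => if f ∈ S then z else 1) y e ≤ Y (G.head e) +
        ∑ f with G.NBStep e f, if f ∉ D ∧ f ∉ S then (1 : ℝ) else 0 := by
      refine (Finset.sum_le_sum fun f _ => hterm f).trans ?_
      rw [Finset.sum_add_distrib, Finset.sum_add_distrib]
      linarith [hsum (G.head e)]
    refine htotal.trans ?_
    rw [Pi.smul_apply, smul_eq_mul]
    -- After a descending edge the only ascending continuation would backtrack, so the bound is `Y
    -- (G.head e) = y e`. After any other edge at most one ascends, and the bound is `δ + 1`.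
    by_cases heD : e ∈ D
    · obtain ⟨v, -, rfl⟩ := Finset.mem_image.1 heD
      rw [Finset.sum_eq_zero]
      · simp only [y, if_pos heD]
        nlinarith [hYpos (G.head (G.inv (p v)))]
      · intro f hf
        have hstep : G.NBStep (G.inv (p v)) f := (Finset.mem_filter.1 hf).2
        rw [if_neg]
        rintro ⟨hfD, hfS⟩
        refine hstep.2 ?_
        rw [G.inv_involutive, hupeq f v hfD hfS]
        rw [← hstep.1, head_inv, (hp v).1]
    · have hone : (∑ f with G.NBStep e f, if f ∉ D ∧ f ∉ S then (1 : ℝ) else 0) ≤ 1 := by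
        rw [← Finset.sum_filter, Finset.sum_const, nsmul_eq_mul, mul_one]
        refine Nat.cast_le_one.2 (Finset.card_le_one.2 fun f hf f' hf' => ?_)
        simp only [Finset.mem_filter, Finset.mem_univ, true_and] at hf hf'
        obtain ⟨v, rfl⟩ := hup f hf.2.1 hf.2.2
        refine (hupeq f' v hf'.2.1 hf'.2.2 ?_).symm
        rw [← hf'.1.1, hf.1.1, (hp v).1]
      simp only [y, if_neg heD]
      linarith [hYδ (G.head e)]

end InvGraph

/-! ### Choice of the constants. -/

theorem theorem7p3 (r : ℕ) (ν : ℝ) (hν : 1 < ν) :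
    ∃ g : ℕ, ∀ (V : Type*) (E : Type*) [Fintype V] [Fintype E] (G : InvGraph V E),
      G.IsTangle ν r → G.girth ≤ (g : ℕ∞) := by
  -- The strict gap `μ < ν` lets an actual eigenvalue be extracted from the supremum defining the
  -- spectral radius.
  obtain ⟨μ, hμ, hμν⟩ := exists_between hν
  obtain ⟨β, hβ, hβμ⟩ := exists_between hμ
  have hβ0 : 0 < β := one_pos.trans hβ
  have hδ : 0 < β - 1 := sub_pos.2 hβ
  obtain ⟨z, hz, hz1, hzδ⟩ : ∃ z : ℝ, 0 < z ∧ z ≤ 1 ∧ z * (2 * r : ℕ) ≤ (β - 1) / 2 := by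
    -- The summand `+ 1` keeps `z` positive when `r = 0`.
    refine ⟨min 1 ((β - 1) / 2 / (2 * r + 1)), by positivity, min_le_left _ _, ?_⟩
    have h1 : min 1 ((β - 1) / 2 / (2 * r + 1)) * (2 * r + 1) ≤ (β - 1) / 2 := by
      rw [← le_div_iff₀ (by positivity)]
      exact min_le_right _ _
    have h2 : 0 ≤ min 1 ((β - 1) / 2 / (2 * (r : ℝ) + 1)) := by positivity
    push_cast
    linarith
  obtain ⟨g, hg⟩ := exists_pow_lt_of_lt_one (pow_pos hz (2 * r))
    ((div_lt_one (hβ0.trans hβμ)).2 hβμ)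
  rw [div_pow, div_lt_iff₀ (pow_pos (hβ0.trans hβμ) g)] at hg
  refine ⟨g, fun V E _ _ G hG => ?_⟩
  obtain ⟨hconn, hmu, hord⟩ := hG
  obtain ⟨S, hS, y, hy, hyβ⟩ := hconn.exists_superharmonic hord hz hδ hzδ
  obtain ⟨a, ha, ha0, haμ⟩ :=
    InvGraph.exists_subharmonic_of_lt_mu1 (hβ0.trans hβμ).le (hμν.trans_le hmu)
  rw [add_sub_cancel] at hyβ
  exact InvGraph.girth_le_of_superharmonic S hz hz1 hβ0.le (hβ0.trans hβμ).le hy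
    hyβ ha ha0 haμ hS hg
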